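/- Let $n,k\ge 0$ be integers and let $A=\{a_1<\cdots<a_{n+1}\}$ be a totally ordered alphabet. All tableaux are semistandard Young tableaux with entries in $A$; ${\rm Tab}(\lambda,\mu)$ is the set of those of shape $\lambda$ and weight $\mu$ (i.e. with $\mu_i$ occurrences of $a_i$). The plactic monoid is the quotient $A^*/{\equiv}$ of the free monoid by the congruence generated by $zxy\equiv xzy$, $yxz\equiv yzx$ ($x<y<z$) and $yxx\equiv xyx$, $yxy\equiv yyx$ ($x<y$); a tableau is identified with the class of its row reading (rows read from left to right, from the shortest row, containing the largest letters, to the longest one). A Yamanouchi tableau is a tableau whose weight equals its shape. For $1\le i\le n$ and a word $w$, consider the subword of the letters $a_i,a_{i+1}$ of $w$ and bracket successively all factors $a_{i+1}a_i$, until the unbracketed letters form a word $a_i^r a_{i+1}^s$. Let $\epsilon_i(w)$ (resp. $\phi_i(w)$) be obtained from $w$ by replacing these letters by $a_i^{r+1}a_{i+1}^{s-1}$ (resp. $a_i^{r-1}a_{i+1}^{s+1}$), with $\epsilon_i(w)=0$ if $s=0$ (resp. $\phi_i(w)=0$ if $r=0$). For a tableau $t$ (acting on its row reading) put $$d_i(t)=\min\{\max\{m\mid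 \epsilon_i^m(t)\neq 0\},\ \max\{m\mid \phi_i^m(t)\neq 0\}\}.$$ For a partition $\lambda$ define $${\bf K}_{\lambda,(k^{n+1})}(x_1,\ldots,x_n)=\sum_{t\in{\rm Tab}(\lambda,(k^{n+1}))}\ \prod_{i=1}^n x_i^{d_i(t)} .$$ Theorem. Let $\lambda$ be a partition. (i) For every $t\in{\rm Tab}(\lambda,(k^{n+1}))$ there exists a unique tableau $u$ of minimal weight such that, in the plactic monoid, $t\cdot u$ is a Yamanouchi tableau; here minimal means that the weight of $u$ is componentwise $\le$ the weight of every tableau $v$ such that $t\cdot v$ is a Yamanouchi tableau. Moreover, $u$ is itself a Yamanouchi tableau, and if $y$ is the Yamanouchi tableau of weight $(k^{n+1})$, one has $$t\,u\equiv u\,y\equiv y\,u .$$ (ii) For $t\in{\rm Tab}(\lambda,(k^{n+1}))$ denote by $\nu(t)$ the weight of the tableau $u$ of (i), which is a partition, and by $\nu'(t)$ its conjugate. For a partition $\mu=(\mu_1,\ldots,\mu_r)$ with positive parts set $x_\mu=x_{\mu_1}x_{\mu_2}\cdots x_{\mu_r}$. Then $${\bf K}_{\lambda,(k^{n+1})}(x_1,\ldots,x_n)=\sum_{t\in{\rm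 Tab}(\lambda,(k^{n+1}))} x_{\nu'(t)} .$$ -/

import Mathlib

/-! ### The plactic monoid -/

/-- The elementary Knuth relations on words over a totally ordered alphabet. -/
inductive KnuthRel (α : Type*) [LinearOrder α] : FreeMonoid α → FreeMonoid α → Prop
  | zxy {x y z : α} (hxy : x < y) (hyz : y < z) :
      KnuthRel α (FreeMonoid.ofList [z, x, y]) (FreeMonoid.ofList [x, z, y])
  | yxz {x y z : α} (hxy : x < y) (hyz : y < z) :
      KnuthRel α (FreeMonoid.ofList [y, x, z]) (FreeMonoid.ofList [y, z, x])
  | yxx {x y : α} (hxy : x < y) :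
      KnuthRel α (FreeMonoid.ofList [y, x, x]) (FreeMonoid.ofList [x, y, x])
  | yxy {x y : α} (hxy : x < y) :
      KnuthRel α (FreeMonoid.ofList [y, x, y]) (FreeMonoid.ofList [y, y, x])

/-- The plactic congruence: the monoid congruence generated by the Knuth relations. -/
def placticCon (α : Type*) [LinearOrder α] : Con (FreeMonoid α) := conGen (KnuthRel α)

/-- The plactic monoid on the alphabet `α`. -/
abbrev Plactic (α : Type*) [LinearOrder α] : Type _ := (placticCon α).Quotient

/-- The class of a word in the plactic monoid. -/
def placticClass {α : Type*} [LinearOrder α] (w : List α) : Plactic α :=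
  ((FreeMonoid.ofList w : FreeMonoid α) : (placticCon α).Quotient)

/-! ### Tableaux

The alphabet `a₁ < ⋯ < aₙ₊₁` is `Fin (n + 1)`; its element `i` (counted from `0`) is the letter
`aᵢ₊₁`. -/

/-- Semistandard Young tableaux of shape `lam` on the alphabet `Fin (n + 1)`.
(Entries outside the diagram are `0` by convention, so the bound concerns only the cells.) -/
def Tableau (n : ℕ) (lam : YoungDiagram) : Type :=
  {T : SemistandardYoungTableau lam // ∀ i j, T i j ≤ n}

/-- Tableaux of arbitrary shape on the alphabet `Fin (n + 1)`. -/
abbrev AnyTableau (n : ℕ) : Type := Σ lam : YoungDiagram, Tableau n lam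

namespace Tableau

variable {n : ℕ} {lam : YoungDiagram}

/-- The letter in row `i`, column `j` (row `0` is the longest one). -/
def letter (T : Tableau n lam) (i j : ℕ) : Fin (n + 1) :=
  ⟨T.1 i j, Nat.lt_succ_of_le (T.2 i j)⟩

/-- The weight: `T.weight a` is the number of occurrences of the letter `a` in `T`. -/
def weight (T : Tableau n lam) (a : Fin (n + 1)) : ℕ :=
  (lam.cells.filter fun c => T.letter c.1 c.2 = a).card

/-- The row reading of a tableau: the rows are read from left to right, starting with the
shortest row (the one with the largest letters) and ending with row `0`. -/
def word (T : Tableau n lam) : List (Fin (n + 1)) :=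
  (List.range (lam.colLen 0)).reverse.flatMap fun i =>
    (List.range (lam.rowLen i)).map fun j => T.letter i j

/-- The element of the plactic monoid represented by a tableau. -/
def toPlactic (T : Tableau n lam) : Plactic (Fin (n + 1)) := placticClass T.word

/-- A Yamanouchi tableau is a tableau whose weight equals its shape. -/
def IsYamanouchi (T : Tableau n lam) : Prop :=
  ∀ a : Fin (n + 1), T.weight a = lam.rowLen a

end Tableau

/-- `Tab(lam, mu)`: the tableaux of shape `lam` and weight `mu`. -/
def Tab (n : ℕ) (lam : YoungDiagram) (mu : Fin (n + 1) → ℕ) : Type :=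
  {T : Tableau n lam // T.weight = mu}

instance Tab.instFinite (n : ℕ) (lam : YoungDiagram) (mu : Fin (n + 1) → ℕ) :
    Finite (Tab n lam mu) := by
  refine Finite.of_injective
    (fun (T : Tab n lam mu) (c : {c // c ∈ lam.cells}) => T.1.letter c.1.1 c.1.2) ?_
  intro T S h
  apply Subtype.ext
  apply Subtype.ext
  ext i j
  by_cases hc : (i, j) ∈ lam
  · have := congrFun h ⟨(i, j), by simpa using hc⟩
    exact congrArg Fin.val this
  · rw [T.1.1.zeros hc, S.1.1.zeros hc]

noncomputable instance Tab.instFintype (n : ℕ) (lam : YoungDiagram) (mu : Fin (n + 1) → ℕ) :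
    Fintype (Tab n lam mu) := Fintype.ofFinite _

/-- The rectangular diagram with `n + 1` rows of length `k`. -/
def rectDiagram (n k : ℕ) : YoungDiagram where
  cells := Finset.range (n + 1) ×ˢ Finset.range k
  isLowerSet := by
    rintro ⟨a, b⟩ ⟨c, d⟩ h hab
    simp only [Prod.mk_le_mk] at h
    simp only [Finset.coe_product, Finset.coe_range, Set.mem_prod, Set.mem_Iio] at hab ⊢
    omega

/-- The Yamanouchi tableau of weight `(k^(n+1))`: `n + 1` rows of length `k`, the `i`-th row being
filled with the `i`-th letter. -/
def rectYamanouchi (n k : ℕ) : Tableau n (rectDiagram n k) :=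
  ⟨SemistandardYoungTableau.highestWeight (rectDiagram n k), fun i j => by
    rw [SemistandardYoungTableau.highestWeight_apply]
    split_ifs with h
    · have h' : (i, j) ∈ Finset.range (n + 1) ×ˢ Finset.range k := h
      simp only [Finset.mem_product, Finset.mem_range] at h'
      omega
    · exact Nat.zero_le n⟩

/-! ### The crystal operators on words, and the exponents of a tableau -/

section Crystal

variable {n : ℕ}

/-- One round of bracketing: remove every factor `aᵢ₊₁ aᵢ`. Each letter carries its position in
the original word. For `i : Fin n`, the letter `aᵢ` is `i.castSucc` and `aᵢ₊₁` is `i.succ`. -/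
def bracketStep (i : Fin n) : List (ℕ × Fin (n + 1)) → List (ℕ × Fin (n + 1))
  | [] => []
  | [x] => [x]
  | x :: y :: w =>
      if x.2 = i.succ ∧ y.2 = i.castSucc then bracketStep i w
      else x :: bracketStep i (y :: w)

/-- The unbracketed letters of `w` in direction `i`, with their positions in `w` (counted from
`0`): restrict `w` to the letters `aᵢ, aᵢ₊₁` and bracket until no factor `aᵢ₊₁ aᵢ` is left
(`w.length` rounds are always enough). What remains has the form `aᵢ^r aᵢ₊₁^s`. -/
def unbracketed (i : Fin n) (w : List (Fin (n + 1))) : List (ℕ × Fin (n + 1)) :=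
  (bracketStep i)^[w.length]
    ((w.zipIdx.map Prod.swap).filter fun x => x.2 = i.castSucc ∨ x.2 = i.succ)

/-- The number `r` of unbracketed letters `aᵢ`. -/
def numFreeLow (i : Fin n) (w : List (Fin (n + 1))) : ℕ :=
  (unbracketed i w).countP fun x => x.2 = i.castSucc

/-- `εᵢ`: on the unbracketed subword, `aᵢ^r aᵢ₊₁^s ↦ aᵢ^(r+1) aᵢ₊₁^(s-1)` if `s ≥ 1`, and `0`
if `s = 0`; all other letters are unchanged. The value `0` is represented by `none`. -/
def epsOp (i : Fin n) (w : List (Fin (n + 1))) : Option (List (Fin (n + 1))) :=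
  match (unbracketed i w)[numFreeLow i w]? with
  | some x => some (w.set x.1 i.castSucc)
  | none => none

/-- `φᵢ`: on the unbracketed subword, `aᵢ^r aᵢ₊₁^s ↦ aᵢ^(r-1) aᵢ₊₁^(s+1)` if `r ≥ 1`, and `0`
if `r = 0`; all other letters are unchanged. The value `0` is represented by `none`. -/
def phiOp (i : Fin n) (w : List (Fin (n + 1))) : Option (List (Fin (n + 1))) :=
  if numFreeLow i w = 0 then none
  else
    match (unbracketed i w)[numFreeLow i w - 1]? with
    | some x => some (w.set x.1 i.succ)
    | none => none

/-- `f^m(w)`, for an operator `f` on words that may take the value `0` (that is, `none`). -/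
def iterOp {α : Type*} (f : α → Option α) (m : ℕ) (w : α) : Option α :=
  (fun o : Option α => o.bind f)^[m] (some w)

/-- The exponent of `t` in direction `i`:
`dᵢ(t) = min {max {m | εᵢ^m(t) ≠ 0}, max {m | φᵢ^m(t) ≠ 0}}`. -/
noncomputable def Tableau.exponent {lam : YoungDiagram} (t : Tableau n lam) (i : Fin n) : ℕ :=
  min (sSup {m : ℕ | iterOp (epsOp i) m t.word ≠ none})
    (sSup {m : ℕ | iterOp (phiOp i) m t.word ≠ none})

end Crystal

/-! ### The multivariate polynomials and the minimal multiplier -/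

/-- The polynomial `K_{lam,(k^(n+1))}(x₁, …, xₙ) = ∑ₜ ∏ᵢ xᵢ^(dᵢ(t))`, summed over
`t ∈ Tab(lam, (k^(n+1)))`. The index `i : Fin n`, counted from `0`, stands for `xᵢ₊₁`. -/
noncomputable def multiKostka (n k : ℕ) (lam : YoungDiagram) : MvPolynomial (Fin n) ℤ :=
  ∑ t : Tab n lam (fun _ => k), ∏ i : Fin n, MvPolynomial.X i ^ t.1.exponent i

/-- In the plactic monoid, the product `t · u` is a Yamanouchi tableau. -/
def MulIsYamanouchi {n : ℕ} {lam : YoungDiagram} (t : Tableau n lam) (u : AnyTableau n) : Prop :=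
  ∃ v : AnyTableau n, v.2.IsYamanouchi ∧ t.toPlactic * u.2.toPlactic = v.2.toPlactic

/-- `u` is a tableau of minimal weight (for the componentwise order, the least one) such that
`t · u` is a Yamanouchi tableau. -/
def IsMinimalMultiplier {n : ℕ} {lam : YoungDiagram} (t : Tableau n lam) (u : AnyTableau n) :
    Prop :=
  MulIsYamanouchi t u ∧ ∀ v : AnyTableau n, MulIsYamanouchi t v → u.2.weight ≤ v.2.weight

/-- The parts `ν'₁, ν'₂, …` of the conjugate of a partition `ν = (ν₁ ≥ ⋯ ≥ νₙ₊₁)`: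
`ν'ⱼ` is the number of `i` with `νᵢ ≥ j`, for `1 ≤ j ≤ max ν`. -/
def conjugateParts {n : ℕ} (nu : Fin (n + 1) → ℕ) : List ℕ :=
  (List.range (Finset.univ.sup nu)).map fun j => (Finset.univ.filter fun i => j + 1 ≤ nu i).card

/-- `x_μ = x_{μ₁} x_{μ₂} ⋯ x_{μᵣ}`, in the ring `ℤ[x₀, x₁, x₂, …]`. -/
noncomputable def partMonomial (mu : List ℕ) : MvPolynomial ℕ ℤ :=
  (mu.map fun m => (MvPolynomial.X m : MvPolynomial ℕ ℤ)).prod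

/-! Bracketing factors aᵢ₊₁aᵢ is computing in the bicyclic monoid with b = aᵢ₊₁, a = aᵢ and ba = 1.
So the numbers (r, s) of unbracketed letters are the value of a monoid homomorphism `sig i`. It
respects the Knuth relations, hence is a plactic invariant, and the maximal powers of εᵢ and φᵢ that
do not vanish are s and r.

Call a word lattice if s = 0 in every direction. A tableau is Yamanouchi iff its reading is lattice.
A lattice word is equivalent to a product of commuting columns a, a - 1, …, 0 whose multiplicities
depend only on the weight (`IsLatticeWord.exists_columnProd`), so lattice words of equal weight are
equivalent. Therefore t · u is Yamanouchi iff the concatenated reading is lattice.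

The product formula turns this into: u is Yamanouchi and sₜ ≤ rᵤ, where rᵤ is the drop of the weight
of u from aᵢ to aᵢ₊₁. For t of constant weight r = s, so sₜ = dᵢ(t) (`mulIsYamanouchi_iff`). The
least weight with drops at least dᵢ(t) is the sequence of tail sums dᵢ + ⋯ + dₙ. The words of tu, uy
and yu are lattice of one weight, hence equivalent. The conjugate of the tail sums has exactly dᵢ
parts equal to i, which gives the polynomial identity. -/

/-! ### The bicyclic monoid and the signature of a word -/

/-- The bicyclic monoid `⟨a, b ∣ b a = 1⟩`; the pair `⟨r, s⟩` stands for `a ^ r * b ^ s`. -/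
@[ext] structure Bicyclic where
  /-- The exponent of `a`. -/
  low : ℕ
  /-- The exponent of `b`. -/
  high : ℕ

namespace Bicyclic

instance : One Bicyclic := ⟨⟨0, 0⟩⟩

/-- In a^r b^s · a^r' b^s' the middle loses min(s, r') pairs ba; the truncated subtractions record
what survives on either side. -/
instance : Mul Bicyclic :=
  ⟨fun x y => ⟨x.low + (y.low - x.high), y.high + (x.high - y.low)⟩⟩

@[simp] theorem one_low : (1 : Bicyclic).low = 0 := rfl
@[simp] theorem one_high : (1 : Bicyclic).high = 0 := rfl
@[simp] theorem mul_low (x y : Bicyclic) : (x * y).low = x.low + (y.low - x.high) := rfl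
@[simp] theorem mul_high (x y : Bicyclic) : (x * y).high = y.high + (x.high - y.low) := rfl

instance : Monoid Bicyclic where
  mul_assoc x y z := by ext <;> simp <;> omega
  one_mul x := by ext <;> simp
  mul_one x := by ext <;> simp

end Bicyclic

section Signature

variable {n : ℕ}

/-- The signature of a letter in direction `i`. -/
def letterSig (i : Fin n) (c : Fin (n + 1)) : Bicyclic :=
  if c = i.castSucc then ⟨1, 0⟩ else if c = i.succ then ⟨0, 1⟩ else 1

/-- The signature of a word in direction `i`: the pair `(r, s)` such that bracketing leaves
`aᵢ ^ r aᵢ₊₁ ^ s`. -/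
def sig (i : Fin n) (w : List (Fin (n + 1))) : Bicyclic := (w.map (letterSig i)).prod

@[simp] theorem letterSig_castSucc (i : Fin n) : letterSig i i.castSucc = ⟨1, 0⟩ := by
  simp [letterSig]

@[simp] theorem letterSig_succ (i : Fin n) : letterSig i i.succ = ⟨0, 1⟩ := by
  simp [letterSig, Fin.ext_iff]

theorem letterSig_of_ne {i : Fin n} {c : Fin (n + 1)} (h : c ≠ i.castSucc) (h' : c ≠ i.succ) :
    letterSig i c = 1 := by
  simp [letterSig, h, h']

@[simp] theorem sig_nil (i : Fin n) : sig i [] = 1 := rfl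

@[simp] theorem sig_cons (i : Fin n) (c : Fin (n + 1)) (w : List (Fin (n + 1))) :
    sig i (c :: w) = letterSig i c * sig i w := by
  simp [sig]

@[simp] theorem sig_append (i : Fin n) (v w : List (Fin (n + 1))) :
    sig i (v ++ w) = sig i v * sig i w := by
  simp [sig]

theorem sig_eq_one {i : Fin n} {w : List (Fin (n + 1))}
    (h : ∀ c ∈ w, c ≠ i.castSucc ∧ c ≠ i.succ) : sig i w = 1 := by
  induction w with
  | nil => rfl
  | cons c w ih =>
    rw [sig_cons, ih fun d hd => h d (by simp [hd]),
      letterSig_of_ne (h c (by simp)).1 (h c (by simp)).2, one_mul]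

theorem sig_replicate (i : Fin n) (c : Fin (n + 1)) (l : ℕ) :
    sig i (List.replicate l c) =
      ⟨if c = i.castSucc then l else 0, if c = i.succ then l else 0⟩ := by
  induction l with
  | zero => ext <;> simp
  | succ l ih =>
    rw [List.replicate_succ, sig_cons, ih, letterSig]
    have : i.castSucc ≠ i.succ := by simp [Fin.ext_iff]
    ext <;> split_ifs <;> simp_all <;> omega

/-- Bracketing removes the two letters in pairs, so r - s is the difference of their multiplicities;
the additive form avoids subtraction. -/
theorem sig_low_add_count (i : Fin n) (w : List (Fin (n + 1))) :
    (sig i w).low + w.count i.succ = (sig i w).high + w.count i.castSucc := by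
  induction w with
  | nil => simp
  | cons c w ih =>
    have : i.castSucc ≠ i.succ := by simp [Fin.ext_iff]
    simp only [sig_cons, List.count_cons, letterSig, beq_iff_eq, Bicyclic.mul_low,
      Bicyclic.mul_high]
    split_ifs <;> simp_all <;> omega

/-! ### Plactic invariance of the signature -/

theorem placticClass_append {α : Type*} [LinearOrder α] (v w : List α) :
    placticClass (v ++ w) = placticClass v * placticClass w := rfl

theorem placticClass_knuth {α : Type*} [LinearOrder α] {v w : List α}
    (h : KnuthRel α (FreeMonoid.ofList v) (FreeMonoid.ofList w)) :
    placticClass v = placticClass w :=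
  (Con.eq _).2 (ConGen.Rel.of _ _ h)

theorem placticClass_lift {α M : Type*} [LinearOrder α] [Monoid M] (f : α → M)
    (hf : ∀ v w : FreeMonoid α, KnuthRel α v w → (v.toList.map f).prod = (w.toList.map f).prod)
    {v w : List α} (h : placticClass v = placticClass w) :
    (v.map f).prod = (w.map f).prod := by
  have h1 : placticCon α ≤ Con.ker (FreeMonoid.lift f) :=
    Con.conGen_le.2 fun v w hvw => by
      change FreeMonoid.lift f v = FreeMonoid.lift f w
      rw [FreeMonoid.lift_apply, FreeMonoid.lift_apply]
      exact hf v w hvw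
  have h2 := h1 ((Con.eq _).1 h)
  rw [Con.ker_rel, FreeMonoid.lift_apply, FreeMonoid.lift_apply] at h2
  exact h2

/-- A Knuth relation with x < y < z exchanges x and z, which cannot be aᵢ and aᵢ₊₁ because y lies
strictly between, so their images commute. The relations with a repeated letter reduce to baa = aba
and bab = bba, which follow from ba = 1. -/
theorem sig_eq_of_placticClass_eq (i : Fin n) {v w : List (Fin (n + 1))}
    (h : placticClass v = placticClass w) : sig i v = sig i w := by
  refine placticClass_lift (letterSig i) ?_ h
  have : i.castSucc ≠ i.succ := by simp [Fin.ext_iff]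
  rintro _ _ (⟨h1, h2⟩ | ⟨h1, h2⟩ | ⟨h1⟩ | ⟨h1⟩) <;>
    simp only [FreeMonoid.toList_ofList, List.map_cons, List.map_nil, List.prod_cons,
      List.prod_nil, mul_one, letterSig] <;>
    simp only [Fin.lt_def, Fin.ext_iff, Fin.val_castSucc, Fin.val_succ] at * <;>
    split_ifs <;> first | omega | (ext <;> simp)

/-- A word is a lattice word (or Yamanouchi word) if all operators `εᵢ` vanish on it. -/
def IsLatticeWord (w : List (Fin (n + 1))) : Prop := ∀ i : Fin n, (sig i w).high = 0

/-- A letter aᵢ₊₁ is cancelled only by letters to its right, so a prefix cannot repair a suffix. -/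
theorem IsLatticeWord.of_append {v w : List (Fin (n + 1))} (h : IsLatticeWord (v ++ w)) :
    IsLatticeWord w := fun i => by
  have := h i
  simp only [sig_append, Bicyclic.mul_high] at this
  omega

theorem IsLatticeWord.of_isSuffix {v w : List (Fin (n + 1))} (h : IsLatticeWord w)
    (hv : v <:+ w) : IsLatticeWord v := by
  obtain ⟨u, rfl⟩ := hv
  exact h.of_append

theorem IsLatticeWord.congr {v w : List (Fin (n + 1))} (h : IsLatticeWord w)
    (hvw : placticClass v = placticClass w) : IsLatticeWord v := fun i => by
  rw [sig_eq_of_placticClass_eq i hvw, h i]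

theorem IsLatticeWord.low_add_count {w : List (Fin (n + 1))} (h : IsLatticeWord w) (i : Fin n) :
    (sig i w).low + w.count i.succ = w.count i.castSucc := by
  rw [sig_low_add_count, h i, zero_add]

end Signature

/-! ### Bracketing computes the signature -/

section Bracketing

variable {n : ℕ}

theorem length_bracketStep_le (i : Fin n) (L : List (ℕ × Fin (n + 1))) :
    (bracketStep i L).length ≤ L.length := by
  fun_induction bracketStep i L <;> simp_all <;> omega

/-- No factor `aᵢ₊₁ aᵢ` occurs. -/
def IsBracketFree (i : Fin n) (L : List (ℕ × Fin (n + 1))) : Prop :=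
  L.IsChain fun x y => ¬ (x.2 = i.succ ∧ y.2 = i.castSucc)

theorem bracketStep_of_isBracketFree {i : Fin n} {L : List (ℕ × Fin (n + 1))}
    (h : IsBracketFree i L) : bracketStep i L = L := by
  unfold IsBracketFree at h
  fun_induction bracketStep i L <;> simp_all

theorem isBracketFree_or_length_bracketStep_lt (i : Fin n) (L : List (ℕ × Fin (n + 1))) :
    IsBracketFree i L ∨ (bracketStep i L).length < L.length := by
  unfold IsBracketFree
  fun_induction bracketStep i L with
  | case1 => simp
  | case2 => simp
  | case3 x y w h ih =>
    right
    have := length_bracketStep_le i w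
    simp; omega
  | case4 x y w h ih =>
    rcases ih with ih | ih
    · left; simp_all
    · right; simpa using ih

/-- As long as a factor aᵢ₊₁aᵢ remains, a round strictly shortens the list; a bracket-free list is a
fixed point. -/
theorem isBracketFree_iterate_bracketStep (i : Fin n) (m : ℕ) (L : List (ℕ × Fin (n + 1)))
    (hm : L.length ≤ m) : IsBracketFree i ((bracketStep i)^[m] L) := by
  induction m generalizing L with
  | zero => simp_all [IsBracketFree]
  | succ m ih =>
    rw [Function.iterate_succ_apply]
    rcases isBracketFree_or_length_bracketStep_lt i L with h | h
    · rw [bracketStep_of_isBracketFree h, Function.iterate_fixed (bracketStep_of_isBracketFree h)]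
      exact h
    · exact ih _ (by omega)

theorem mem_of_mem_bracketStep {i : Fin n} {L : List (ℕ × Fin (n + 1))} {x : ℕ × Fin (n + 1)}
    (h : x ∈ bracketStep i L) : x ∈ L := by
  fun_induction bracketStep i L <;> simp_all <;> tauto

theorem sig_bracketStep (i : Fin n) (L : List (ℕ × Fin (n + 1))) :
    sig i ((bracketStep i L).map Prod.snd) = sig i (L.map Prod.snd) := by
  fun_induction bracketStep i L with
  | case1 => rfl
  | case2 => rfl
  | case3 x y w h ih =>
    rw [ih, List.map_cons, List.map_cons, sig_cons, sig_cons, h.1, h.2, ← mul_assoc]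
    ext <;> simp
  | case4 x y w h ih => simp only [List.map_cons, sig_cons, ih]

/-- `L'` is obtained from `L` by deleting letters such that the factors on both sides of every
remaining letter keep their signatures. -/
def SigRefines (i : Fin n) (L L' : List (ℕ × Fin (n + 1))) : Prop :=
  ∀ A x B, L' = A ++ x :: B → ∃ A' B', L = A' ++ x :: B' ∧
    sig i (A'.map Prod.snd) = sig i (A.map Prod.snd) ∧
    sig i (B'.map Prod.snd) = sig i (B.map Prod.snd)

theorem SigRefines.trans {i : Fin n} {L L' L'' : List (ℕ × Fin (n + 1))}
    (h : SigRefines i L L') (h' : SigRefines i L' L'') : SigRefines i L L'' := by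
  intro A x B e
  obtain ⟨A', B', e', h1, h2⟩ := h' A x B e
  obtain ⟨A'', B'', e'', h3, h4⟩ := h A' x B' e'
  exact ⟨A'', B'', e'', h3.trans h1, h4.trans h2⟩

theorem sigRefines_bracketStep (i : Fin n) (L : List (ℕ × Fin (n + 1))) :
    SigRefines i L (bracketStep i L) := by
  fun_induction bracketStep i L with
  | case1 => intro A x B h; exact ⟨A, B, h, rfl, rfl⟩
  | case2 => intro A x B h; exact ⟨A, B, h, rfl, rfl⟩
  | case3 x y w h ih =>
    intro A z B e
    obtain ⟨A', B', e', h1, h2⟩ := ih A z B e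
    refine ⟨x :: y :: A', B', by rw [e']; rfl, ?_, h2⟩
    rw [List.map_cons, List.map_cons, sig_cons, sig_cons, h.1, h.2, ← mul_assoc, h1]
    ext <;> simp
  | case4 x y w h ih =>
    intro A z B e
    rcases A with _ | ⟨a, A⟩
    · simp only [List.nil_append, List.cons.injEq] at e
      obtain ⟨rfl, e⟩ := e
      exact ⟨[], y :: w, rfl, rfl, by rw [← e, sig_bracketStep]⟩
    · simp only [List.cons_append, List.cons.injEq] at e
      obtain ⟨rfl, e⟩ := e
      obtain ⟨A', B', e', h1, h2⟩ := ih A z B e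
      exact ⟨x :: A', B', by rw [e']; rfl, by simp [h1], h2⟩

theorem sigRefines_iterate_bracketStep (i : Fin n) (m : ℕ) (L : List (ℕ × Fin (n + 1))) :
    SigRefines i L ((bracketStep i)^[m] L) := by
  induction m generalizing L with
  | zero => intro A x B h; exact ⟨A, B, h, rfl, rfl⟩
  | succ m ih => exact (sigRefines_bracketStep i L).trans (ih _)

theorem sig_iterate_bracketStep (i : Fin n) (m : ℕ) (L : List (ℕ × Fin (n + 1))) :
    sig i (((bracketStep i)^[m] L).map Prod.snd) = sig i (L.map Prod.snd) := by
  induction m generalizing L with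
  | zero => rfl
  | succ m ih => rw [Function.iterate_succ_apply, ih, sig_bracketStep]

theorem mem_of_mem_iterate_bracketStep {i : Fin n} {m : ℕ} {L : List (ℕ × Fin (n + 1))}
    {x : ℕ × Fin (n + 1)} (h : x ∈ (bracketStep i)^[m] L) : x ∈ L := by
  induction m generalizing L with
  | zero => exact h
  | succ m ih => exact mem_of_mem_bracketStep (ih h)

theorem sig_filter (i : Fin n) (L : List (ℕ × Fin (n + 1))) :
    sig i ((L.filter fun x => x.2 = i.castSucc ∨ x.2 = i.succ).map Prod.snd) =
      sig i (L.map Prod.snd) := by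
  induction L with
  | nil => rfl
  | cons x L ih =>
    by_cases h : x.2 = i.castSucc ∨ x.2 = i.succ
    · rw [List.filter_cons_of_pos (by simpa using h), List.map_cons, sig_cons, ih,
        List.map_cons, sig_cons]
    · rw [List.filter_cons_of_neg (by simpa using h), ih, List.map_cons, sig_cons,
        letterSig_of_ne (by tauto) (by tauto), one_mul]

theorem sigRefines_filter (i : Fin n) (L : List (ℕ × Fin (n + 1))) :
    SigRefines i L (L.filter fun x => x.2 = i.castSucc ∨ x.2 = i.succ) := by
  intro A x B e
  obtain ⟨A', C, rfl, hA, hC⟩ := List.filter_eq_append_iff.1 e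
  obtain ⟨D, B', rfl, hD, -, hB⟩ := List.filter_eq_cons_iff.1 hC
  refine ⟨A' ++ D, B', by simp, ?_, by rw [← hB, sig_filter]⟩
  rw [← hA, sig_filter, List.map_append, sig_append, sig_eq_one (w := D.map Prod.snd), mul_one]
  simp only [List.mem_map, forall_exists_index, and_imp]
  rintro c x hx rfl
  simpa [not_or] using hD x hx

theorem map_snd_zipIdx_swap {α : Type*} (w : List α) :
    ((w.zipIdx.map Prod.swap).map Prod.snd) = w := by
  rw [List.map_map]
  exact List.zipIdx_map_fst 0 w

theorem sig_unbracketed (i : Fin n) (w : List (Fin (n + 1))) :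
    sig i ((unbracketed i w).map Prod.snd) = sig i w := by
  rw [unbracketed, sig_iterate_bracketStep, sig_filter, map_snd_zipIdx_swap]

theorem IsBracketFree.exists_append {i : Fin n} {L : List (ℕ × Fin (n + 1))}
    (h : IsBracketFree i L) (hL : ∀ x ∈ L, x.2 = i.castSucc ∨ x.2 = i.succ) :
    ∃ r s, L.map Prod.snd = List.replicate r i.castSucc ++ List.replicate s i.succ := by
  induction L with
  | nil => exact ⟨0, 0, rfl⟩
  | cons x L ih =>
    have hc : IsBracketFree i L := by
      unfold IsBracketFree at h ⊢
      exact h.tail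
    obtain ⟨r, s, e⟩ := ih hc fun y hy => hL y (by simp [hy])
    rcases hL x (by simp) with hx | hx
    · exact ⟨r + 1, s, by simp [e, hx, List.replicate_succ]⟩
    · rcases r with _ | r
      · exact ⟨0, s + 1, by simp [e, hx, List.replicate_succ]⟩
      · exfalso
        rcases L with _ | ⟨y, L⟩
        · simp at e
        · rw [List.replicate_succ] at e
          simp only [List.map_cons, List.cons_append, List.cons.injEq] at e
          unfold IsBracketFree at h
          simp only [List.isChain_cons_cons] at h
          exact h.1 ⟨hx, e.1⟩

/-- A bracket-free word in two letters has the form a^r b^s, whose signature is (r, s); bracketing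
preserves the signature, so r and s are those of w. -/
theorem map_snd_unbracketed (i : Fin n) (w : List (Fin (n + 1))) :
    (unbracketed i w).map Prod.snd =
      List.replicate (sig i w).low i.castSucc ++ List.replicate (sig i w).high i.succ := by
  have h1 : IsBracketFree i (unbracketed i w) :=
    isBracketFree_iterate_bracketStep i _ _ ((List.length_filter_le _ _).trans (by simp))
  obtain ⟨r, s, e⟩ := h1.exists_append fun x hx => by
    have := (List.mem_filter.1 (mem_of_mem_iterate_bracketStep hx)).2
    simpa using this
  have h2 := sig_unbracketed i w
  have h3 : i.castSucc ≠ i.succ := by simp [Fin.ext_iff]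
  rw [e, sig_append, sig_replicate, sig_replicate] at h2
  rw [e, ← h2]
  simp [h3, h3.symm]

theorem numFreeLow_eq (i : Fin n) (w : List (Fin (n + 1))) :
    numFreeLow i w = (sig i w).low := by
  have h3 : i.succ ≠ i.castSucc := by simp [Fin.ext_iff]
  have : numFreeLow i w = ((unbracketed i w).map Prod.snd).count i.castSucc := by
    rw [List.count, List.countP_map]
    simp only [numFreeLow]
    congr 1
  rw [this, map_snd_unbracketed, List.count_append, List.count_replicate_self,
    List.count_replicate]
  simp [h3]

theorem length_unbracketed (i : Fin n) (w : List (Fin (n + 1))) :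
    (unbracketed i w).length = (sig i w).low + (sig i w).high := by
  rw [← List.length_map (f := Prod.snd), map_snd_unbracketed]
  simp

/-- Replacing the `m`-th unbracketed letter. -/
theorem sig_set_unbracketed (i : Fin n) (w : List (Fin (n + 1))) (c : Fin (n + 1)) (m : ℕ)
    {x : ℕ × Fin (n + 1)} (hx : (unbracketed i w)[m]? = some x) :
    sig i (w.set x.1 c) =
      sig i (((unbracketed i w).map Prod.snd).take m) * letterSig i c *
        sig i (((unbracketed i w).map Prod.snd).drop (m + 1)) := by
  obtain ⟨hm, hx⟩ := List.getElem?_eq_some_iff.1 hx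
  have e : unbracketed i w = (unbracketed i w).take m ++ x :: (unbracketed i w).drop (m + 1) := by
    rw [← hx, List.cons_getElem_drop_succ, List.take_append_drop]
  -- The cut at the m-th unbracketed letter is lifted to a cut of the whole indexed word with the
  -- same signatures on both sides. Decomposing `zipIdx` then shows that the stored position is the
  -- length of the left part, so `set` acts exactly at the cut.
  obtain ⟨A, B, e', hA, hB⟩ := ((sigRefines_filter i _).trans
    (sigRefines_iterate_bracketStep i w.length _)) _ _ _ e
  obtain ⟨A', C', e2, hA', hC⟩ := List.map_eq_append_iff.1 e'
  obtain ⟨y, B', rfl, hy, hB'⟩ := List.map_eq_cons_iff.1 hC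
  obtain ⟨u, v, rfl, hu, hv⟩ := List.zipIdx_eq_append_iff.1 e2
  obtain ⟨a, v', rfl, rfl, hv'⟩ := List.zipIdx_eq_cons_iff.1 hv.symm
  have hsu : A.map Prod.snd = u := by
    rw [← hA', hu, map_snd_zipIdx_swap]
  have hsv : B.map Prod.snd = v' := by
    rw [← hB', hv', List.map_map]; exact List.zipIdx_map_fst _ _
  rw [List.map_take, List.map_drop] at *
  rw [← hA, ← hB, hsu, hsv, ← hy]
  simp [mul_assoc]

theorem epsOp_eq_none {i : Fin n} {w : List (Fin (n + 1))} (h : (sig i w).high = 0) :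
    epsOp i w = none := by
  have : (unbracketed i w)[numFreeLow i w]? = none := by
    rw [List.getElem?_eq_none_iff, length_unbracketed, numFreeLow_eq, h]; omega
  simp [epsOp, this]

/-- Index r, counted from 0, is the leftmost unbracketed aᵢ₊₁; changing it leaves the signature of
a^(r+1) b^s. -/
theorem exists_epsOp_eq_some {i : Fin n} {w : List (Fin (n + 1))} {s : ℕ}
    (h : (sig i w).high = s + 1) :
    ∃ w', epsOp i w = some w' ∧ (sig i w').high = s := by
  have hlt : numFreeLow i w < (unbracketed i w).length := by
    rw [length_unbracketed, numFreeLow_eq]; omega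
  have hx := List.getElem?_eq_getElem hlt
  refine ⟨_, by simp only [epsOp, hx]; rfl, ?_⟩
  rw [sig_set_unbracketed i w _ _ hx, map_snd_unbracketed, numFreeLow_eq, h]
  have h3 : i.succ ≠ i.castSucc := by simp [Fin.ext_iff]
  rw [List.take_append_of_le_length (by simp), List.drop_append]
  simp [sig_replicate, h3, h3.symm]

theorem phiOp_eq_none {i : Fin n} {w : List (Fin (n + 1))} (h : (sig i w).low = 0) :
    phiOp i w = none := by
  simp [phiOp, numFreeLow_eq, h]

theorem exists_phiOp_eq_some {i : Fin n} {w : List (Fin (n + 1))} {r : ℕ}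
    (h : (sig i w).low = r + 1) :
    ∃ w', phiOp i w = some w' ∧ (sig i w').low = r := by
  have hlt : numFreeLow i w - 1 < (unbracketed i w).length := by
    rw [length_unbracketed, numFreeLow_eq]; omega
  have hx := List.getElem?_eq_getElem hlt
  refine ⟨_, by simp only [phiOp, hx]; rw [if_neg (by rw [numFreeLow_eq]; omega)], ?_⟩
  rw [sig_set_unbracketed i w _ _ hx, map_snd_unbracketed, numFreeLow_eq, h]
  have h3 : i.succ ≠ i.castSucc := by simp [Fin.ext_iff]
  rw [List.take_append_of_le_length (by simp), List.drop_append]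
  simp [sig_replicate, h3, h3.symm]

/-! ### Lengths of strings of crystal operators -/

theorem iterOp_succ {α : Type*} (f : α → Option α) (m : ℕ) (w : α) :
    iterOp f (m + 1) w = (f w).bind (iterOp f m) := by
  unfold iterOp
  rw [Function.iterate_succ_apply, Option.bind_some]
  cases f w with
  | none =>
    rw [Option.bind_none]
    exact Function.iterate_fixed (f := fun o : Option α => o.bind f) (x := none) rfl m
  | some w' => rfl

/-- An operator that vanishes where the function `d` vanishes, and lowers `d` by one elsewhere, can
be applied exactly `d` times. -/
theorem sSup_iterOp {α : Type*} (f : α → Option α) (d : α → ℕ) (h0 : ∀ w, d w = 0 → f w = none)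
    (h1 : ∀ w s, d w = s + 1 → ∃ w', f w = some w' ∧ d w' = s) (w : α) :
    sSup {m : ℕ | iterOp f m w ≠ none} = d w := by
  have key : ∀ m w, iterOp f m w ≠ none ↔ m ≤ d w := by
    intro m
    induction m with
    | zero => intro w; simp [iterOp]
    | succ m ih =>
      intro w
      rw [iterOp_succ]
      rcases hd : d w with _ | s
      · simp [h0 w hd]
      · obtain ⟨w', e, e'⟩ := h1 w s hd
        rw [e, Option.bind_some, ih, e']
        omega
  simp only [key]
  exact csSup_Iic

theorem Tableau.exponent_eq {lam : YoungDiagram} (t : Tableau n lam) (i : Fin n) :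
    t.exponent i = min (sig i t.word).high (sig i t.word).low := by
  rw [Tableau.exponent, sSup_iterOp (epsOp i) (fun w => (sig i w).high)
    (fun w => epsOp_eq_none) (fun w s => exists_epsOp_eq_some),
    sSup_iterOp (phiOp i) (fun w => (sig i w).low)
    (fun w => phiOp_eq_none) (fun w s => exists_phiOp_eq_some)]

end Bracketing

/-! ### Columns, and the equivalence of lattice words of equal weight -/

section Columns

theorem placticClass_cons {α : Type*} [LinearOrder α] (a : α) (w : List α) :
    placticClass (a :: w) = placticClass [a] * placticClass w := rfl

theorem placticClass_cons_congr {α : Type*} [LinearOrder α] (a : α) {v w : List α}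
    (h : placticClass v = placticClass w) : placticClass (a :: v) = placticClass (a :: w) := by
  rw [placticClass_cons, h, ← placticClass_cons]

theorem placticClass_append_right_congr {α : Type*} [LinearOrder α] {v w : List α}
    (h : placticClass v = placticClass w) (u : List α) :
    placticClass (v ++ u) = placticClass (w ++ u) := by
  rw [placticClass_append, h, ← placticClass_append]

/-- Unites the relations `zxy` (x < y) and `yxx` (x = y); `placticClass_swap_right` does the same
for `yxz` and `yxy`. -/
theorem placticClass_swap_left {α : Type*} [LinearOrder α] {x y z : α} (hxy : x ≤ y)
    (hyz : y < z) (w : List α) :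
    placticClass (x :: z :: y :: w) = placticClass (z :: x :: y :: w) := by
  refine placticClass_append_right_congr (v := [x, z, y]) (w := [z, x, y]) ?_ w
  rcases hxy.lt_or_eq with h | rfl
  · exact (placticClass_knuth (.zxy h hyz)).symm
  · exact (placticClass_knuth (.yxx hyz)).symm

theorem placticClass_swap_right {α : Type*} [LinearOrder α] {x y z : α} (hxy : x < y)
    (hyz : y ≤ z) (w : List α) :
    placticClass (y :: z :: x :: w) = placticClass (y :: x :: z :: w) := by
  refine placticClass_append_right_congr (v := [y, z, x]) (w := [y, x, z]) ?_ w
  rcases hyz.lt_or_eq with h | rfl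
  · exact (placticClass_knuth (.yxz hxy h)).symm
  · exact (placticClass_knuth (.yxy hxy)).symm

/-- The extra x passes each larger letter z of the column, because the letter y following z
satisfies x ≤ y < z. -/
theorem placticClass_cons_column {α : Type*} [LinearOrder α] {x : α} {A B : List α}
    (h : (A ++ x :: B).IsChain (· > ·)) :
    placticClass (x :: (A ++ x :: B)) = placticClass (A ++ x :: x :: B) := by
  induction A with
  | nil => rfl
  | cons z A ih =>
    have h' : (A ++ x :: B).IsChain (· > ·) := by
      rw [List.cons_append] at h; exact h.tail
    rw [List.cons_append, List.cons_append, ← placticClass_cons_congr z (ih h')]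
    rcases A with _ | ⟨y, A⟩
    · simp only [List.nil_append, List.cons_append, List.isChain_cons_cons] at h ⊢
      exact placticClass_swap_left le_rfl h.1 B
    · simp only [List.cons_append, List.isChain_cons_cons] at h h' ⊢
      refine placticClass_swap_left ?_ h.1 _
      have h'' : (y :: (A ++ x :: B)).Pairwise (· > ·) := List.isChain_iff_pairwise.1 h'
      exact ((List.pairwise_cons.1 h'').1 x (by simp)).le

/-- Here z travels to the right end: it passes each letter x because the letter y to its left
satisfies x < y ≤ z. -/
theorem placticClass_column_concat {α : Type*} [LinearOrder α] {y z : α} {B : List α}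
    (h : (y :: B).IsChain (· > ·)) (hyz : y ≤ z) :
    placticClass (y :: z :: B) = placticClass (y :: B ++ [z]) := by
  induction B generalizing y with
  | nil => rfl
  | cons x B ih =>
    rw [List.isChain_cons_cons] at h
    rw [placticClass_swap_right h.1 hyz, placticClass_cons_congr y (ih h.2 (h.1.le.trans hyz))]
    rfl

/-- A strictly decreasing word commutes with each of its letters. -/
theorem commute_letter_column {α : Type*} [LinearOrder α] {x : α} {L : List α}
    (h : L.IsChain (· > ·)) (hx : x ∈ L) :
    Commute (placticClass [x]) (placticClass L) := by
  obtain ⟨A, B, rfl⟩ := List.append_of_mem hx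
  change placticClass [x] * _ = _ * placticClass [x]
  rw [← placticClass_cons, placticClass_cons_column h, placticClass_append,
    placticClass_column_concat h.right_of_append le_rfl, ← placticClass_append,
    ← placticClass_append, List.append_assoc]

theorem commute_of_forall_letter {α : Type*} [LinearOrder α] {L : List α} {p : Plactic α}
    (h : ∀ x ∈ L, Commute (placticClass [x]) p) : Commute (placticClass L) p := by
  induction L with
  | nil => exact Commute.one_left p
  | cons x L ih =>
    rw [placticClass_cons]
    exact (h x (by simp)).mul_left (ih fun y hy => h y (by simp [hy]))

variable {n : ℕ}

/-- The column `a, a - 1, …, 0`. -/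
def column (a : Fin (n + 1)) : List (Fin (n + 1)) :=
  Fin.induction [0] (fun i L => i.succ :: L) a

@[simp] theorem column_zero : column (0 : Fin (n + 1)) = [0] := rfl

@[simp] theorem column_succ (i : Fin n) : column i.succ = i.succ :: column i.castSucc :=
  Fin.induction_succ _ _ _

theorem mem_column {a b : Fin (n + 1)} : b ∈ column a ↔ b ≤ a := by
  induction a using Fin.induction with
  | zero => simp
  | succ i ih =>
    rw [column_succ, List.mem_cons, ih]
    simp only [Fin.le_def, Fin.ext_iff, Fin.val_succ, Fin.val_castSucc]
    omega

theorem isChain_column (a : Fin (n + 1)) : (column a).IsChain (· > ·) := by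
  rw [List.isChain_iff_pairwise]
  induction a using Fin.induction with
  | zero => simp
  | succ i ih =>
    rw [column_succ, List.pairwise_cons]
    refine ⟨fun b hb => ?_, ih⟩
    rw [mem_column] at hb
    exact hb.trans_lt i.castSucc_lt_succ

/-- Every letter of the shorter column occurs in the longer one, hence commutes with it. -/
theorem commute_column (a b : Fin (n + 1)) :
    Commute (placticClass (column a)) (placticClass (column b)) := by
  rcases le_total a b with h | h
  · exact commute_of_forall_letter fun x hx =>
      commute_letter_column (isChain_column b) (mem_column.2 ((mem_column.1 hx).trans h))
  · exact (commute_of_forall_letter fun x hx =>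
      commute_letter_column (isChain_column a) (mem_column.2 ((mem_column.1 hx).trans h))).symm

theorem pairwise_commute_columnPowers : Pairwise fun a b : Fin (n + 1) =>
    ∀ x y : Multiplicative ℕ,
      Commute (powersHom (Plactic (Fin (n + 1))) (placticClass (column a)) x)
        (powersHom (Plactic (Fin (n + 1))) (placticClass (column b)) y) := fun a b _ x y => by
  simp only [powersHom_apply]
  exact (commute_column a b).pow_pow _ _

/-- The product of the columns, the column of greatest letter `a` being taken `m a` times. -/
noncomputable def columnProd :
    (Fin (n + 1) → Multiplicative ℕ) →* Plactic (Fin (n + 1)) :=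
  MonoidHom.noncommPiCoprod (fun a => powersHom _ (placticClass (column a)))
    pairwise_commute_columnPowers

/-- The multiplicity function of a single column. -/
def columnUnit (a : Fin (n + 1)) : Fin (n + 1) → Multiplicative ℕ :=
  Pi.mulSingle a (Multiplicative.ofAdd 1)

theorem toAdd_columnUnit (a b : Fin (n + 1)) :
    (columnUnit a b).toAdd = if a = b then 1 else 0 := by
  by_cases h : a = b
  · subst h; simp [columnUnit]
  · simp [h, columnUnit]

theorem columnProd_columnUnit (a : Fin (n + 1)) :
    columnProd (columnUnit a) = placticClass (column a) := by
  refine (MonoidHom.noncommPiCoprod_mulSingle _ _ _).trans ?_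
  simp

/-- The word is built from the right. A new letter 0 is a new column; a new letter j + 1 is put on
top of a column with greatest letter j, brought to the front by commutation. -/
theorem IsLatticeWord.exists_columnProd {w : List (Fin (n + 1))} (hw : IsLatticeWord w) :
    ∃ m : Fin (n + 1) → Multiplicative ℕ, placticClass w = columnProd m ∧
      (∀ i : Fin n, (m i.castSucc).toAdd + w.count i.succ = w.count i.castSucc) ∧
      (m (Fin.last n)).toAdd = w.count (Fin.last n) := by
  induction w with
  | nil => exact ⟨1, (map_one _).symm, fun i => rfl, rfl⟩
  | cons c w ih =>
    obtain ⟨m, hm, hi, hl⟩ := ih (hw.of_append (v := [c]))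
    cases c using Fin.cases with
    | zero =>
      refine ⟨columnUnit 0 * m, ?_, fun i => ?_, ?_⟩
      · rw [map_mul, columnProd_columnUnit, placticClass_cons, hm, column_zero]
      · have := hi i
        rw [Pi.mul_apply, toAdd_mul, toAdd_columnUnit]
        simp only [List.count_cons, beq_iff_eq]
        rw [if_neg (Fin.succ_ne_zero i).symm]
        omega
      · rw [Pi.mul_apply, toAdd_mul, toAdd_columnUnit]
        simp only [List.count_cons, beq_iff_eq]
        omega
    | succ j =>
      -- Since `j.succ :: w` is lattice, w contains more letters j than j + 1, so such a column is
      -- available.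
      have hj : (m j.castSucc).toAdd ≠ 0 := by
        have h1 := hi j
        have h2 := hw.low_add_count j
        have h3 : j.succ ≠ j.castSucc := by simp [Fin.ext_iff]
        simp only [List.count_cons, beq_self_eq_true, if_true, beq_iff_eq, h3, if_false] at h2
        omega
      obtain ⟨m', hm'⟩ : ∃ m' : Fin (n + 1) → Multiplicative ℕ, m = columnUnit j.castSucc * m' := by
        refine ⟨fun b => Multiplicative.ofAdd
          ((m b).toAdd - if j.castSucc = b then 1 else 0), ?_⟩
        funext b
        apply Multiplicative.toAdd.injective
        rw [Pi.mul_apply, toAdd_mul, toAdd_columnUnit, toAdd_ofAdd]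
        split_ifs with h
        · subst h; omega
        · omega
      have hmb : ∀ b, (m b).toAdd = (if j.castSucc = b then 1 else 0) + (m' b).toAdd := by
        intro b; rw [hm', Pi.mul_apply, toAdd_mul, toAdd_columnUnit]
      refine ⟨columnUnit j.succ * m', ?_, fun i => ?_, ?_⟩
      · rw [placticClass_cons, hm, hm', map_mul, map_mul, columnProd_columnUnit,
          columnProd_columnUnit, column_succ, placticClass_cons j.succ (column _), mul_assoc]
      · have h1 := hi i
        rw [hmb] at h1
        rw [Pi.mul_apply, toAdd_mul, toAdd_columnUnit]
        simp only [List.count_cons, beq_iff_eq, Fin.succ_inj, Fin.castSucc_inj] at h1 ⊢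
        omega
      · rw [hmb] at hl
        rw [Pi.mul_apply, toAdd_mul, toAdd_columnUnit]
        simp only [List.count_cons, beq_iff_eq]
        rw [if_neg (Fin.castSucc_ne_last j)] at hl
        omega

/-- Two lattice words of the same weight are plactically equivalent. -/
theorem IsLatticeWord.placticClass_eq {v w : List (Fin (n + 1))} (hv : IsLatticeWord v)
    (hw : IsLatticeWord w) (h : ∀ a, v.count a = w.count a) :
    placticClass v = placticClass w := by
  obtain ⟨m, hm, hi, hl⟩ := hv.exists_columnProd
  obtain ⟨m', hm', hi', hl'⟩ := hw.exists_columnProd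
  have : m = m' := by
    funext a
    apply Multiplicative.toAdd.injective
    cases a using Fin.lastCases with
    | last => rw [hl, hl', h]
    | cast i =>
      have h1 := hi i
      have h2 := hi' i
      rw [h, h] at h1
      omega
  rw [hm, hm', this]

end Columns

/-! ### Yamanouchi tableaux -/

namespace Tableau

variable {n : ℕ} {lam : YoungDiagram}

/-- The reading of row `i`. -/
def rowWord (T : Tableau n lam) (i : ℕ) : List (Fin (n + 1)) :=
  (List.range (lam.rowLen i)).map fun j => T.letter i j

/-- The reading of the rows `m - 1, …, 0`. -/
def rowsWord (T : Tableau n lam) (m : ℕ) : List (Fin (n + 1)) :=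
  (List.range m).reverse.flatMap T.rowWord

theorem word_eq_rowsWord (T : Tableau n lam) : T.word = T.rowsWord (lam.colLen 0) := rfl

theorem rowsWord_succ (T : Tableau n lam) (m : ℕ) :
    T.rowsWord (m + 1) = T.rowWord m ++ T.rowsWord m := by
  simp [rowsWord, List.range_succ]

theorem rowsWord_isSuffix (T : Tableau n lam) {i m : ℕ} (h : i ≤ m) :
    T.rowsWord i <:+ T.rowsWord m := by
  induction m, h using Nat.le_induction with
  | base => exact List.suffix_rfl
  | succ m _ ih => rw [rowsWord_succ]; exact ih.trans (List.suffix_append _ _)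

theorem count_rowWord (T : Tableau n lam) (i : ℕ) (a : Fin (n + 1)) :
    (T.rowWord i).count a =
      ∑ j ∈ Finset.range (lam.rowLen i), if T.letter i j = a then 1 else 0 := by
  rw [rowWord]
  induction lam.rowLen i with
  | zero => simp
  | succ l ih =>
    rw [List.range_succ, List.map_append, List.count_append, ih, Finset.sum_range_succ]
    simp [List.count_singleton]

theorem count_rowsWord (T : Tableau n lam) (m : ℕ) (a : Fin (n + 1)) :
    (T.rowsWord m).count a = ∑ i ∈ Finset.range m, (T.rowWord i).count a := by
  induction m with
  | zero => simp [rowsWord]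
  | succ m ih =>
    rw [rowsWord_succ, List.count_append, ih, Finset.sum_range_succ, add_comm]

theorem lt_colLen_of_mem {i j : ℕ} (h : (i, j) ∈ lam) : i < lam.colLen 0 :=
  YoungDiagram.mem_iff_lt_colLen.1 (lam.up_left_mem le_rfl (Nat.zero_le j) h)

theorem count_word (T : Tableau n lam) (a : Fin (n + 1)) : T.word.count a = T.weight a := by
  rw [word_eq_rowsWord, count_rowsWord, weight, Finset.card_filter]
  simp only [count_rowWord]
  symm
  refine Finset.sum_finset_product _ _ _ fun p => ?_
  rw [Finset.mem_range, Finset.mem_range, ← YoungDiagram.mem_iff_lt_rowLen, YoungDiagram.mem_cells]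
  exact ⟨fun h => ⟨lt_colLen_of_mem h, h⟩, fun h => h.2⟩

theorem row_le_entry (T : Tableau n lam) {i j : ℕ} (h : (i, j) ∈ lam) : i ≤ T.1 i j := by
  induction i with
  | zero => exact Nat.zero_le _
  | succ i ih =>
    exact (ih (lam.up_left_mem i.le_succ le_rfl h)).trans_lt (T.1.col_strict i.lt_succ_self h)

/-- All entries of row `i` are equal to `i`. -/
def IsHighest (T : Tableau n lam) : Prop := ∀ i j, (i, j) ∈ lam → T.1 i j = i

theorem rowLen_eq_zero (T : Tableau n lam) {i : ℕ} (h : n < i) : lam.rowLen i = 0 := by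
  by_contra h0
  have h1 : (i, 0) ∈ lam := YoungDiagram.mem_iff_lt_rowLen.2 (Nat.pos_of_ne_zero h0)
  have := T.row_le_entry h1
  have := T.2 i 0
  omega

/-- Column strictness confines the letter i to rows 0, …, i, and by induction the rows before row i
contain only smaller letters. So all letters i lie in row i, and having as many of them as cells
they fill it. -/
theorem isYamanouchi_iff_isHighest {T : Tableau n lam} : T.IsYamanouchi ↔ T.IsHighest := by
  constructor
  · intro h i
    induction i using Nat.strong_induction_on with
    | _ i ih =>
      intro j hj
      have hi : i < n + 1 := Nat.lt_succ_of_le ((T.row_le_entry hj).trans (T.2 i j))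
      have hsub : (lam.cells.filter fun c => T.letter c.1 c.2 = ⟨i, hi⟩) ⊆ lam.row i := by
        rintro ⟨r, c⟩ hc
        rw [Finset.mem_filter, YoungDiagram.mem_cells] at hc
        have he : T.1 r c = i := congrArg Fin.val hc.2
        have hr : r ≤ i := he ▸ T.row_le_entry hc.1
        rcases hr.lt_or_eq with hr | rfl
        · have := ih r hr c hc.1
          omega
        · exact YoungDiagram.mk_mem_row_iff.2 hc.1
      have heq := Finset.eq_of_subset_of_card_le hsub (by
        rw [← YoungDiagram.rowLen_eq_card]; exact (h ⟨i, hi⟩).ge)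
      have : (i, j) ∈ lam.row i := YoungDiagram.mk_mem_row_iff.2 hj
      rw [← heq, Finset.mem_filter] at this
      exact congrArg Fin.val this.2
  · intro h a
    rw [YoungDiagram.rowLen_eq_card, weight]
    congr 1
    ext ⟨r, c⟩
    rw [Finset.mem_filter, YoungDiagram.mem_cells, YoungDiagram.mem_row_iff]
    refine and_congr_right fun hc => ?_
    rw [Fin.ext_iff]
    change T.1 r c = a ↔ r = a
    rw [h r c hc]

theorem IsHighest.rowWord_eq {T : Tableau n lam} (h : T.IsHighest) (a : Fin (n + 1)) :
    T.rowWord a = List.replicate (lam.rowLen a) a := by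
  rw [List.eq_replicate_iff]
  refine ⟨by simp [rowWord], fun b hb => ?_⟩
  simp only [rowWord, List.mem_map, List.mem_range] at hb
  obtain ⟨j, hj, rfl⟩ := hb
  exact Fin.ext (h a j (YoungDiagram.mem_iff_lt_rowLen.2 hj))

/-- Only rows i and i + 1 contribute. Row i + 1 is read first and is not longer than row i, so all
its letters are bracketed. -/
theorem IsHighest.sig_rowsWord {T : Tableau n lam} (h : T.IsHighest) (i : Fin n) (m : ℕ)
    (hm : m ≤ n + 1) : sig i (T.rowsWord m) = ⟨if (i : ℕ) < m then
      lam.rowLen i - (if (i : ℕ) + 1 < m then lam.rowLen (i + 1) else 0) else 0, 0⟩ := by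
  induction m with
  | zero => rfl
  | succ m ih =>
    have hr := h.rowWord_eq ⟨m, hm⟩
    have hanti := lam.rowLen_anti i (i + 1) (Nat.le_succ _)
    simp only at hr
    rw [rowsWord_succ, sig_append, ih (by omega), hr, sig_replicate]
    simp only [Fin.ext_iff, Fin.val_castSucc, Fin.val_succ]
    rcases lt_trichotomy m i with h1 | h1 | h1
    · ext <;> simp <;> split_ifs <;> omega
    · subst h1; ext <;> simp
    · rcases Nat.eq_or_lt_of_le (Nat.succ_le_of_lt h1) with h2 | h2
      · have h3 : m = i + 1 := h2.symm
        subst h3; ext <;> simp <;> omega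
      · ext <;> simp <;> split_ifs <;> omega

theorem IsHighest.isLatticeWord {T : Tableau n lam} (h : T.IsHighest) :
    IsLatticeWord T.word := fun i => by
  have hle : lam.colLen 0 ≤ n + 1 := by
    by_contra hlt
    have h1 : (n + 1, 0) ∈ lam := YoungDiagram.mem_iff_lt_colLen.2 (not_le.1 hlt)
    rw [YoungDiagram.mem_iff_lt_rowLen, T.rowLen_eq_zero (Nat.lt_succ_self n)] at h1
    exact h1.false
  rw [word_eq_rowsWord, h.sig_rowsWord i _ hle]

/-- By induction the rows read after row i contain only letters below i. If the last letter c of row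
i exceeded i, no c - 1 would follow it, and the suffix starting at c would have c unbracketed. -/
theorem isHighest_of_isLatticeWord {T : Tableau n lam} (h : IsLatticeWord T.word) :
    T.IsHighest := by
  intro i
  induction i using Nat.strong_induction_on with
  | _ i ih =>
    intro j hj
    obtain ⟨l, hl⟩ : ∃ l, lam.rowLen i = l + 1 :=
      Nat.exists_eq_succ_of_ne_zero (by have := YoungDiagram.mem_iff_lt_rowLen.1 hj; omega)
    have hlast : (i, l) ∈ lam := YoungDiagram.mem_iff_lt_rowLen.2 (by omega)
    have hjl : j ≤ l := by have := YoungDiagram.mem_iff_lt_rowLen.1 hj; omega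
    have hle : T.1 i j ≤ T.1 i l := T.1.row_weak_of_le hjl hlast
    suffices hs : T.1 i l ≤ i from le_antisymm (hle.trans hs) (T.row_le_entry hj)
    by_contra hlt
    have hsuf : T.letter i l :: T.rowsWord i <:+ T.word := by
      rw [word_eq_rowsWord]
      refine List.IsSuffix.trans ?_ (T.rowsWord_isSuffix (Nat.succ_le_of_lt (lt_colLen_of_mem hj)))
      rw [rowsWord_succ, rowWord, hl, List.range_succ, List.map_append, List.append_assoc]
      exact List.suffix_append _ _
    obtain ⟨b, hb⟩ : ∃ b : Fin n, b.succ = T.letter i l :=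
      Fin.exists_succ_eq.2 fun h0 => by
        have : T.1 i l = 0 := congrArg Fin.val h0
        omega
    have hbi : (b : ℕ) + 1 = T.1 i l := congrArg Fin.val hb
    have h1 := h.of_isSuffix hsuf b
    rw [sig_cons, sig_eq_one (w := T.rowsWord i), ← hb, letterSig_succ] at h1
    · simp at h1
    · intro c hc
      simp only [rowsWord, rowWord, List.mem_flatMap, List.mem_reverse, List.mem_range,
        List.mem_map] at hc
      obtain ⟨r, hr, q, hq, rfl⟩ := hc
      have h2 : T.1 r q = r := ih r hr q (YoungDiagram.mem_iff_lt_rowLen.2 hq)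
      have h3 : ((T.letter r q : Fin (n + 1)) : ℕ) = r := h2
      simp only [ne_eq, Fin.ext_iff, Fin.val_castSucc, Fin.val_succ, h3]
      omega

theorem isYamanouchi_iff_isLatticeWord {T : Tableau n lam} :
    T.IsYamanouchi ↔ IsLatticeWord T.word :=
  isYamanouchi_iff_isHighest.trans ⟨fun h => h.isLatticeWord, isHighest_of_isLatticeWord⟩

end Tableau

variable {n : ℕ} in
theorem AnyTableau.eq_of_weight_eq {u v : AnyTableau n} (hu : u.2.IsYamanouchi)
    (hv : v.2.IsYamanouchi) (h : u.2.weight = v.2.weight) : u = v := by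
  obtain ⟨lam, T⟩ := u
  obtain ⟨mu, S⟩ := v
  simp only at hu hv h
  have hrow : ∀ i, lam.rowLen i = mu.rowLen i := fun i => by
    by_cases hi : i < n + 1
    · rw [← hu ⟨i, hi⟩, ← hv ⟨i, hi⟩, h]
    · rw [T.rowLen_eq_zero (by omega), S.rowLen_eq_zero (by omega)]
  have : lam = mu := by
    apply YoungDiagram.ext
    ext ⟨i, j⟩
    rw [YoungDiagram.mem_cells, YoungDiagram.mem_cells, YoungDiagram.mem_iff_lt_rowLen,
      YoungDiagram.mem_iff_lt_rowLen, hrow]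
  subst this
  congr 1
  apply Subtype.ext
  ext i j
  by_cases hc : (i, j) ∈ lam
  · rw [Tableau.isYamanouchi_iff_isHighest.1 hu i j hc,
      Tableau.isYamanouchi_iff_isHighest.1 hv i j hc]
  · rw [T.1.zeros hc, S.1.zeros hc]

/-- The Young diagram with row lengths `N 0 ≥ ⋯ ≥ N n`. -/
def diagramOfRows (n : ℕ) (N : ℕ → ℕ) (hN : Antitone N) : YoungDiagram where
  cells := (Finset.range (n + 1) ×ˢ Finset.range (N 0)).filter fun c => c.2 < N c.1
  isLowerSet := by
    rintro ⟨a, b⟩ ⟨c, d⟩ h hab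
    simp only [Prod.mk_le_mk] at h
    simp only [Finset.coe_filter, Finset.mem_product, Finset.mem_range, Set.mem_ofPred_eq] at hab ⊢
    have := hN h.1
    omega

theorem mem_diagramOfRows {n : ℕ} {N : ℕ → ℕ} {hN : Antitone N} {i j : ℕ} :
    (i, j) ∈ diagramOfRows n N hN ↔ i < n + 1 ∧ j < N i := by
  change (i, j) ∈ (Finset.range (n + 1) ×ˢ Finset.range (N 0)).filter _ ↔ _
  simp only [Finset.mem_filter, Finset.mem_product, Finset.mem_range]
  have := hN (Nat.zero_le i)
  omega

theorem exists_yamanouchi (n : ℕ) (N : ℕ → ℕ) (hN : Antitone N) :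
    ∃ u : AnyTableau n, u.2.IsYamanouchi ∧ ∀ a, u.2.weight a = N a := by
  let T : Tableau n (diagramOfRows n N hN) :=
    ⟨SemistandardYoungTableau.highestWeight _, fun i j => by
      rw [SemistandardYoungTableau.highestWeight_apply]
      split_ifs with h
      · have := mem_diagramOfRows.1 h; omega
      · exact Nat.zero_le n⟩
  have hT : T.IsYamanouchi := Tableau.isYamanouchi_iff_isHighest.2 fun i j h => by
    change SemistandardYoungTableau.highestWeight _ i j = i
    rw [SemistandardYoungTableau.highestWeight_apply, if_pos h]
  refine ⟨⟨_, T⟩, hT, fun a => (hT a).trans (eq_of_forall_lt_iff fun j => ?_)⟩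
  rw [← YoungDiagram.mem_iff_lt_rowLen, mem_diagramOfRows]
  exact and_iff_right a.2

theorem rectYamanouchi_isYamanouchi (n k : ℕ) : (rectYamanouchi n k).IsYamanouchi :=
  Tableau.isYamanouchi_iff_isHighest.2 fun i j h => by
    change SemistandardYoungTableau.highestWeight _ i j = i
    rw [SemistandardYoungTableau.highestWeight_apply, if_pos h]

theorem rectYamanouchi_weight (n k : ℕ) (a : Fin (n + 1)) : (rectYamanouchi n k).weight a = k := by
  refine (rectYamanouchi_isYamanouchi n k a).trans (eq_of_forall_lt_iff fun j => ?_)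
  rw [← YoungDiagram.mem_iff_lt_rowLen]
  change ((a : ℕ), j) ∈ Finset.range (n + 1) ×ˢ Finset.range k ↔ _
  rw [Finset.mem_product, Finset.mem_range, Finset.mem_range]
  exact and_iff_right a.2

/-! ### Multipliers of a tableau of constant weight -/

section Multiplier

variable {n : ℕ}

/-- The weight of a lattice word is weakly decreasing, so it is the shape of a Yamanouchi tableau,
whose reading is a lattice word of the same weight. -/
theorem IsLatticeWord.exists_yamanouchi {w : List (Fin (n + 1))} (hw : IsLatticeWord w) :
    ∃ v : AnyTableau n, v.2.IsYamanouchi ∧ placticClass w = v.2.toPlactic := by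
  obtain ⟨v, hv, hvw⟩ := _root_.exists_yamanouchi n
    (fun j => if h : j < n + 1 then w.count ⟨j, h⟩ else 0) <| antitone_nat_of_succ_le fun j => by
      by_cases h : j + 1 < n + 1
      · have := hw.low_add_count ⟨j, by omega⟩
        rw [dif_pos h, dif_pos (by omega)]
        simp only [Fin.succ_mk, Fin.castSucc_mk] at this
        omega
      · rw [dif_neg h]; exact Nat.zero_le _
  refine ⟨v, hv, hw.placticClass_eq (Tableau.isYamanouchi_iff_isLatticeWord.1 hv) fun a => ?_⟩
  rw [v.2.count_word, hvw a, dif_pos a.2]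

theorem mulIsYamanouchi_iff_isLatticeWord {lam : YoungDiagram} {t : Tableau n lam}
    {u : AnyTableau n} : MulIsYamanouchi t u ↔ IsLatticeWord (t.word ++ u.2.word) := by
  constructor
  · rintro ⟨v, hv, h⟩
    exact (Tableau.isYamanouchi_iff_isLatticeWord.1 hv).congr h
  · exact fun h => h.exists_yamanouchi

/-- Constant weight forces r = s, so the minimum defining the exponent is either of them. -/
theorem sig_high_eq_exponent {lam : YoungDiagram} {k : ℕ} (t : Tab n lam fun _ => k) (i : Fin n) :
    (sig i t.1.word).high = t.1.exponent i := by
  have hk : ∀ a, t.1.word.count a = k := fun a => (t.1.count_word a).trans (congrFun t.2 a)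
  have h := sig_low_add_count i t.1.word
  rw [hk, hk] at h
  rw [t.1.exponent_eq]
  omega

/-- The product has s = sᵤ + (sₜ - rᵤ), truncated. It vanishes iff sᵤ = 0 and sₜ ≤ rᵤ, and for
lattice u the number rᵤ is a difference of consecutive weights. -/
theorem mulIsYamanouchi_iff {lam : YoungDiagram} {k : ℕ} {t : Tab n lam fun _ => k}
    {u : AnyTableau n} : MulIsYamanouchi t.1 u ↔ u.2.IsYamanouchi ∧
      ∀ i : Fin n, t.1.exponent i + u.2.weight i.succ ≤ u.2.weight i.castSucc := by
  rw [mulIsYamanouchi_iff_isLatticeWord, Tableau.isYamanouchi_iff_isLatticeWord]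
  constructor
  · intro h
    refine ⟨h.of_append, fun i => ?_⟩
    have h1 := h.of_append.low_add_count i
    have h2 := h i
    rw [sig_append, Bicyclic.mul_high, sig_high_eq_exponent] at h2
    rw [u.2.count_word, u.2.count_word] at h1
    omega
  · rintro ⟨hu, h⟩ i
    have h1 := hu.low_add_count i
    rw [u.2.count_word, u.2.count_word] at h1
    rw [sig_append, Bicyclic.mul_high, sig_high_eq_exponent, hu i]
    have := h i
    omega

/-- The tail sums `d i + ⋯ + d (n - 1)`. -/
def tailSum (d : Fin n → ℕ) (i : ℕ) : ℕ :=
  ∑ j ∈ Finset.Ico i n, if h : j < n then d ⟨j, h⟩ else 0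

theorem tailSum_of_le (d : Fin n → ℕ) {i : ℕ} (h : n ≤ i) : tailSum d i = 0 := by
  rw [tailSum, Finset.Ico_eq_empty_of_le h, Finset.sum_empty]

theorem tailSum_eq_add (d : Fin n → ℕ) (i : Fin n) : tailSum d i = d i + tailSum d (i + 1) := by
  rw [tailSum, Finset.sum_eq_sum_Ico_succ_bot i.2, dif_pos i.2, tailSum]

theorem antitone_tailSum (d : Fin n → ℕ) : Antitone (tailSum d) := fun _ _ h =>
  Finset.sum_le_sum_of_subset (Finset.Ico_subset_Ico_left h)

/-- Adding the inequalities of `mulIsYamanouchi_iff` from the last letter downwards bounds every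
multiplier below by the tail sums, which satisfy all of them with equality. -/
theorem exists_isMinimalMultiplier {lam : YoungDiagram} {k : ℕ} (t : Tab n lam fun _ => k) :
    ∃ u : AnyTableau n, IsMinimalMultiplier t.1 u ∧ u.2.IsYamanouchi ∧
      ∀ a, u.2.weight a = tailSum t.1.exponent a := by
  obtain ⟨u, hu, hw⟩ := exists_yamanouchi n (tailSum t.1.exponent) (antitone_tailSum _)
  have key : ∀ v, MulIsYamanouchi t.1 v →
      ∀ a : Fin (n + 1), tailSum t.1.exponent a ≤ v.2.weight a := by
    intro v hv a
    induction a using Fin.reverseInduction with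
    | last => rw [Fin.val_last, tailSum_of_le _ le_rfl]; exact Nat.zero_le _
    | cast i ih =>
      have h1 := (mulIsYamanouchi_iff.1 hv).2 i
      have h2 := tailSum_eq_add t.1.exponent i
      rw [Fin.val_succ] at ih
      rw [Fin.val_castSucc]
      omega
  refine ⟨u, ⟨mulIsYamanouchi_iff.2 ⟨hu, fun i => ?_⟩, fun v hv a => ?_⟩, hu, hw⟩
  · rw [hw, hw]
    exact (tailSum_eq_add _ i).ge
  · rw [hw]
    exact key v hv a

theorem IsMinimalMultiplier.unique {lam : YoungDiagram} {k : ℕ} {t : Tab n lam fun _ => k}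
    {u v : AnyTableau n} (hu : IsMinimalMultiplier t.1 u) (hv : IsMinimalMultiplier t.1 v) :
    v = u :=
  AnyTableau.eq_of_weight_eq (mulIsYamanouchi_iff.1 hv.1).1 (mulIsYamanouchi_iff.1 hu.1).1
    (le_antisymm (hv.2 u hu.1) (hu.2 v hv.1))

theorem Tableau.IsYamanouchi.isLatticeWord_append {lam mu : YoungDiagram} {u : Tableau n lam}
    {v : Tableau n mu} (hu : u.IsYamanouchi) (hv : v.IsYamanouchi) :
    IsLatticeWord (u.word ++ v.word) := fun i => by
  rw [sig_append, Bicyclic.mul_high, Tableau.isYamanouchi_iff_isLatticeWord.1 hu i,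
    Tableau.isYamanouchi_iff_isLatticeWord.1 hv i, Nat.zero_sub]

/-- Both sides are classes of lattice words of the same weight, since t and y have the same weight;
minimality of u plays no role. -/
theorem MulIsYamanouchi.mul_eq_mul_rectYamanouchi {lam : YoungDiagram} {k : ℕ}
    {t : Tab n lam fun _ => k} {u : AnyTableau n} (h : MulIsYamanouchi t.1 u) :
    t.1.toPlactic * u.2.toPlactic = u.2.toPlactic * (rectYamanouchi n k).toPlactic := by
  refine (mulIsYamanouchi_iff_isLatticeWord.1 h).placticClass_eq
    ((mulIsYamanouchi_iff.1 h).1.isLatticeWord_append (rectYamanouchi_isYamanouchi n k)) fun a => ?_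
  change (t.1.word ++ u.2.word).count a = (u.2.word ++ (rectYamanouchi n k).word).count a
  rw [List.count_append, List.count_append, (rectYamanouchi n k).count_word,
    rectYamanouchi_weight, t.1.count_word, congrFun t.2 a, add_comm]

theorem Tableau.IsYamanouchi.commute {lam mu : YoungDiagram} {u : Tableau n lam}
    {v : Tableau n mu} (hu : u.IsYamanouchi) (hv : v.IsYamanouchi) :
    Commute u.toPlactic v.toPlactic :=
  (hu.isLatticeWord_append hv).placticClass_eq (hv.isLatticeWord_append hu) fun a => by
    change (u.word ++ v.word).count a = (v.word ++ u.word).count a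
    rw [List.count_append, List.count_append, add_comm]

/-! ### The conjugate partition -/

/-- Tail sums decrease, so those exceeding j form the initial segment 0, …, i. The interval of such
j has length `d i`: this is the multiplicity of the part i + 1 in the conjugate. -/
theorem card_filter_tailSum (d : Fin n → ℕ) (i : Fin n) {j : ℕ} (h1 : tailSum d (i + 1) ≤ j)
    (h2 : j < tailSum d i) :
    (Finset.univ.filter fun a : Fin (n + 1) => j + 1 ≤ tailSum d a).card = i + 1 := by
  have : (Finset.univ.filter fun a : Fin (n + 1) => j + 1 ≤ tailSum d a) =
      Finset.Iic i.castSucc := by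
    ext a
    rw [Finset.mem_filter, Finset.mem_Iic, and_iff_right (Finset.mem_univ a), Fin.le_def,
      Fin.val_castSucc]
    constructor
    · intro h
      by_contra hlt
      have := antitone_tailSum d (show (i : ℕ) + 1 ≤ a by omega)
      omega
    · intro h
      have := antitone_tailSum d h
      omega
  rw [this, Fin.card_Iic, Fin.val_castSucc]

theorem prod_Ico_of_antitone {M : Type*} [CommMonoid M] {N : ℕ → ℕ} (hN : Antitone N)
    (g : ℕ → M) (m : ℕ) : ∏ j ∈ Finset.Ico (N m) (N 0), g j =
      ∏ i ∈ Finset.range m, ∏ j ∈ Finset.Ico (N (i + 1)) (N i), g j := by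
  induction m with
  | zero => simp
  | succ m ih =>
    rw [Finset.prod_range_succ, ← ih, mul_comm,
      Finset.prod_Ico_consecutive _ (hN m.le_succ) (hN m.zero_le)]

theorem partMonomial_conjugateParts (d : Fin n → ℕ) :
    partMonomial (conjugateParts fun a : Fin (n + 1) => tailSum d a) =
      ∏ i : Fin n, (MvPolynomial.X ((i : ℕ) + 1) : MvPolynomial ℕ ℤ) ^ d i := by
  have hsup : Finset.univ.sup (fun a : Fin (n + 1) => tailSum d a) = tailSum d 0 :=
    le_antisymm (Finset.sup_le fun a _ => antitone_tailSum d a.val.zero_le)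
      (Finset.le_sup (f := fun a : Fin (n + 1) => tailSum d a) (Finset.mem_univ 0))
  have hlist : ∀ (f : ℕ → MvPolynomial ℕ ℤ) (l : ℕ),
      ((List.range l).map f).prod = ∏ j ∈ Finset.range l, f j := fun f l => by
    induction l with
    | zero => rfl
    | succ l ih => rw [List.prod_range_succ, ih, Finset.prod_range_succ]
  rw [partMonomial, conjugateParts, hsup, List.map_map, hlist, Finset.range_eq_Ico]
  have := prod_Ico_of_antitone (antitone_tailSum d) ((fun m : ℕ =>
    (MvPolynomial.X m : MvPolynomial ℕ ℤ)) ∘ fun j =>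
      (Finset.univ.filter fun a : Fin (n + 1) => j + 1 ≤ tailSum d a).card) n
  -- The last tail sum is 0, so the intervals between consecutive tail sums cover all j below the
  -- first one.
  rw [tailSum_of_le d le_rfl] at this
  rw [this, Finset.prod_range]
  refine Finset.prod_congr rfl fun i _ => ?_
  rw [Finset.prod_congr rfl (g := fun _ => MvPolynomial.X ((i : ℕ) + 1)) fun j hj => ?_,
    Finset.prod_const, Nat.card_Ico, tailSum_eq_add, Nat.add_sub_cancel]
  rw [Finset.mem_Ico] at hj
  rw [Function.comp_apply, card_filter_tailSum d i hj.1 hj.2]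

end Multiplier

/-- `rename` passes from directions counted from 0 to variables indexed by the size of a part. No
part n + 1 arises, because the minimal u does not contain the last letter. -/
theorem mainTheorem2 (n k : ℕ) (lam : YoungDiagram) :
    ∃ u : Tab n lam (fun _ => k) → AnyTableau n,
      (∀ t : Tab n lam (fun _ => k),
        (IsMinimalMultiplier t.1 (u t) ∧
          ∀ v : AnyTableau n, IsMinimalMultiplier t.1 v → v = u t) ∧
        (u t).2.IsYamanouchi ∧
        t.1.toPlactic * (u t).2.toPlactic =
          (u t).2.toPlactic * (rectYamanouchi n k).toPlactic ∧
        (u t).2.toPlactic * (rectYamanouchi n k).toPlactic =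
          (rectYamanouchi n k).toPlactic * (u t).2.toPlactic) ∧
      MvPolynomial.rename (fun i : Fin n => (i : ℕ) + 1) (multiKostka n k lam) =
        ∑ t : Tab n lam (fun _ => k), partMonomial (conjugateParts (u t).2.weight) := by
  choose u hu hy hw using fun t : Tab n lam (fun _ => k) => exists_isMinimalMultiplier t
  refine ⟨u, fun t => ⟨⟨hu t, fun v hv => (hu t).unique hv⟩, hy t,
    (hu t).1.mul_eq_mul_rectYamanouchi, (hy t).commute (rectYamanouchi_isYamanouchi n k)⟩, ?_⟩
  rw [multiKostka, map_sum]
  refine Finset.sum_congr rfl fun t _ => ?_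
  rw [funext (hw t), partMonomial_conjugateParts, map_prod]
  simp only [map_pow, MvPolynomial.rename_X]
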